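/- An oriented graph is a digraph without loops in which any two distinct vertices are joined by at most one arc. The minimum degree $\delta(D)$ of an oriented graph $D$ is the minimum degree of its underlying undirected graph. A digraph is antidirected if each of its vertices is a source (has no incoming arc) or a sink (has no outgoing arc). For $r\in\mathbb{N}$, the transitive tournament $TT_r$ is the unique acyclic orientation of the complete graph $K_r$. Theorem 1.2. There exists a function $f\colon\mathbb{N}^2\to\mathbb{N}$ such that, for all $r,d\in\mathbb{N}$, every finite nonempty oriented graph $D$ with $\delta(D)\ge f(r,d)$ contains $TT_r$ as a subdigraph or contains a nonempty induced subdigraph $H$ that is antidirected and satisfies $\delta(H)\ge d$. -/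

import Mathlib

namespace Digraph

/-- An oriented graph is a digraph with no loop and at most one arc between any two vertices.
The case `u = v` excludes loops. -/
def IsOriented {V : Type*} (D : Digraph V) : Prop :=
  ∀ u v : V, D.Adj u v → ¬ D.Adj v u

/-- The minimum degree of (the underlying graph of) a finite digraph. -/
noncomputable def minDegree {V : Type*} [Fintype V] (D : Digraph V) : ℕ :=
  letI : DecidableRel D.toSimpleGraphInclusive.Adj := Classical.decRel _
  D.toSimpleGraphInclusive.minDegree

/-- The subdigraph of `D` induced by the vertex set `S`. -/
def induce {V : Type*} (D : Digraph V) (S : Finset V) : Digraph S where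
  Adj u v := D.Adj u v

/-- A source is a vertex without incoming arcs. -/
def IsSource {V : Type*} (D : Digraph V) (v : V) : Prop :=
  ∀ u : V, ¬ D.Adj u v

/-- A sink is a vertex without outgoing arcs. -/
def IsSink {V : Type*} (D : Digraph V) (v : V) : Prop :=
  ∀ u : V, ¬ D.Adj v u

/-- A digraph is antidirected if each of its vertices is a source or a sink. -/
def IsAntidirected {V : Type*} (D : Digraph V) : Prop :=
  ∀ v : V, D.IsSource v ∨ D.IsSink v

/-- `D.Contains F`: the digraph `D` has a subdigraph isomorphic to `F`. -/
def Contains {V W : Type*} (D : Digraph V) (F : Digraph W) : Prop :=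
  ∃ φ : W → V, Function.Injective φ ∧ ∀ u v : W, F.Adj u v → D.Adj (φ u) (φ v)

/-- The transitive tournament of order `r`: the vertices are `0, …, r - 1`, and there is an arc
from `i` to `j` exactly when `i < j`. -/
def transitiveTournament (r : ℕ) : Digraph (Fin r) where
  Adj i j := i < j

end Digraph

section
open Finset Classical

/-! A tournament on 2^r vertices contains TT_r, so it suffices to treat oriented graphs whose
underlying graph G is K_R-free, R = 2^r. Pass to a minimal vertex set W of minimum degree at least
2e. It is 2e-degenerate, so its edges have an auxiliary orientation `P` with out-degrees at most 2e.
At least half of W has degree at most 8e, and at least a quarter, S, has in addition e neighbours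
along arcs of one fixed direction.

Choose A in W at random with density 1/(4e). By Ramsey, a positive proportion of the k-sets among
those e neighbours is independent. Hence with probability at least c(k, R) > 0 a vertex v of S is
good: it sees exactly k vertices of A, all in the fixed direction and none with a `P`-out-neighbour
in A. So some A has more than (ce/2)|A| good vertices.

A K_R-free graph of maximum degree t has an independent set on a fraction s/(2t) of its vertices,
with s as large as desired once t is large (`exists_isIndepSet_mul_card_le`). The good vertices
therefore contain an independent B with |B| ≥ |A|. Dropping the vertices of A with a
`P`-out-neighbour in A makes A independent and costs B no neighbours. All arcs between A and B now
go one way and the average degree is large; deleting low-degree vertices finishes the proof. -/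

/-! ### Transitive subtournaments of cliques -/

theorem Digraph.exists_pairwise_list_of_clique {V : Type*} (D : Digraph V) (r : ℕ) (T : Finset V)
    (hT : ∀ u ∈ T, ∀ v ∈ T, u ≠ v → D.Adj u v ∨ D.Adj v u) (hcard : 2 ^ r ≤ #T) :
    ∃ l : List V, l.length = r ∧ (∀ x ∈ l, x ∈ T) ∧ l.Pairwise D.Adj := by
  induction r generalizing T with
  | zero => exact ⟨[], by simp⟩
  | succ r ih =>
    obtain ⟨v, hv⟩ : T.Nonempty := card_pos.1 (lt_of_lt_of_le (by positivity) hcard)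
    have hsub : T.erase v ⊆ T.filter (fun u => D.Adj v u) ∪ T.filter (fun u => D.Adj u v) := by
      intro u hu
      have := hT v hv u (mem_of_mem_erase hu) (ne_of_mem_erase hu).symm
      simp only [mem_union, mem_filter]
      have := mem_of_mem_erase hu
      tauto
    have h1 := (card_le_card hsub).trans (card_union_le _ _)
    rw [card_erase_of_mem hv] at h1
    have h2 : 2 ^ (r + 1) = 2 * 2 ^ r := by ring
    -- The two neighbourhoods cover at least `2 * 2 ^ r - 1` vertices, so both cannot be below `2 ^
    -- r`.
    have h3 : 2 ^ r ≤ #(T.filter (fun u => D.Adj v u)) ∨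
        2 ^ r ≤ #(T.filter (fun u => D.Adj u v)) := by omega
    rcases h3 with h3 | h3
    · obtain ⟨l, hl, hlT, hp⟩ := ih _ (fun u hu w hw => hT u (mem_filter.1 hu).1 w
        (mem_filter.1 hw).1) h3
      refine ⟨v :: l, by simp [hl], ?_, ?_⟩
      · intro x hx
        rcases List.mem_cons.1 hx with rfl | hx
        · exact hv
        · exact (mem_filter.1 (hlT x hx)).1
      · exact List.pairwise_cons.2 ⟨fun x hx => (mem_filter.1 (hlT x hx)).2, hp⟩
    · obtain ⟨l, hl, hlT, hp⟩ := ih _ (fun u hu w hw => hT u (mem_filter.1 hu).1 w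
        (mem_filter.1 hw).1) h3
      refine ⟨l ++ [v], by simp [hl], ?_, ?_⟩
      · intro x hx
        rcases List.mem_append.1 hx with hx | hx
        · exact (mem_filter.1 (hlT x hx)).1
        · rw [List.mem_singleton.1 hx]; exact hv
      · refine List.pairwise_append.2 ⟨hp, by simp, ?_⟩
        intro x hx y hy
        rw [List.mem_singleton.1 hy]
        exact (mem_filter.1 (hlT x hx)).2

theorem Digraph.cliqueFree_of_not_contains {V : Type*} (D : Digraph V) (hD : D.IsOriented) (r : ℕ)
    (h : ¬ D.Contains (Digraph.transitiveTournament r)) :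
    D.toSimpleGraphInclusive.CliqueFree (2 ^ r) := by
  intro T hT
  apply h
  obtain ⟨l, rfl, -, hp⟩ := D.exists_pairwise_list_of_clique r T (fun u hu v hv huv => by
    have := hT.isClique hu hv huv
    simpa [Digraph.toSimpleGraphInclusive, huv] using this) hT.card_eq.ge
  have hlt : ∀ i j : Fin l.length, i < j → D.Adj (l.get i) (l.get j) :=
    fun i j hij => List.pairwise_iff_get.1 hp i j hij
  refine ⟨l.get, fun i j hij => ?_, hlt⟩
  by_contra hne
  rcases lt_or_gt_of_ne hne with h' | h'
  · have := hlt _ _ h'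
    rw [hij] at this
    exact hD _ _ this this
  · have := hlt _ _ h'
    rw [hij] at this
    exact hD _ _ this this

/-! ### Ramsey bounds and counts of independent sets -/

namespace SimpleGraph

variable {V : Type*} (G : SimpleGraph V)

/-- Greedy choice: each chosen vertex removes itself and fewer than `m` neighbours. -/
theorem exists_isIndepSet_card_le_mul (m : ℕ) (X : Finset V)
    (hX : ∀ v ∈ X, #(X.filter (G.Adj v)) < m) :
    ∃ Y ⊆ X, G.IsIndepSet Y ∧ #X ≤ #Y * m := by
  induction X using Finset.strongInduction with
  | H X ih =>
    rcases X.eq_empty_or_nonempty with rfl | ⟨v, hv⟩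
    · exact ⟨∅, by simp⟩
    · set X' := X.filter (fun u => u ≠ v ∧ ¬ G.Adj v u) with hX'
      have hss : X' ⊂ X := by
        refine ⟨filter_subset _ _, fun h => ?_⟩
        have := h hv
        simp [hX'] at this
      obtain ⟨Y, hYX, hY, hc⟩ := ih X' hss (fun u hu =>
        (card_le_card (filter_subset_filter _ hss.1)).trans_lt (hX u (hss.1 hu)))
      have hvY : v ∉ Y := fun h => by
        have := hYX h
        simp [hX'] at this
      refine ⟨insert v Y, insert_subset hv (hYX.trans hss.1), ?_, ?_⟩
      · rw [coe_insert, SimpleGraph.IsIndepSet, Set.pairwise_insert]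
        refine ⟨hY, fun b hb _ => ?_⟩
        have := (mem_filter.1 (hYX hb)).2.2
        exact ⟨this, fun h => this h.symm⟩
      · have h1 : X ⊆ X' ∪ insert v (X.filter (G.Adj v)) := by
          intro u hu
          simp only [hX', mem_union, mem_filter, mem_insert]
          tauto
        have h2 := (card_le_card h1).trans (card_union_le _ _)
        have h3 := card_insert_le v (X.filter (G.Adj v))
        have h4 := hX v hv
        rw [card_insert_of_notMem hvY, add_mul]
        omega

/-- Ramsey by induction on `R`: either some neighbourhood is large enough for the induction
hypothesis, or all degrees are small and the greedy bound applies. -/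
theorem exists_isIndepSet_of_pow_le_card (R k : ℕ) (X : Finset V)
    (hX : ∀ T ⊆ X, ¬ G.IsNClique R T) (hk : k ^ R ≤ #X) :
    ∃ Y ⊆ X, G.IsIndepSet Y ∧ #Y = k := by
  induction R generalizing X with
  | zero => exact absurd (by simp [isNClique_iff]) (hX ∅ (empty_subset _))
  | succ R ih =>
    by_cases h : ∃ v ∈ X, k ^ R ≤ #(X.filter (G.Adj v))
    · obtain ⟨v, hv, hvc⟩ := h
      obtain ⟨Y, hYX, hY⟩ := ih (X.filter (G.Adj v)) (fun T hT hc => by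
        refine hX (insert v T) (insert_subset hv (hT.trans (filter_subset _ _))) ?_
        exact hc.insert (fun b hb => (mem_filter.1 (hT hb)).2)) hvc
      exact ⟨Y, hYX.trans (filter_subset _ _), hY⟩
    · push Not at h
      rcases Nat.eq_zero_or_pos k with rfl | hk0
      · exact ⟨∅, by simp⟩
      obtain ⟨Y, hYX, hY, hc⟩ := G.exists_isIndepSet_card_le_mul _ X h
      have : k ≤ #Y := by
        have h1 : k * k ^ R ≤ #Y * k ^ R := by
          rw [← pow_succ']; exact hk.trans hc
        exact Nat.le_of_mul_le_mul_right h1 (by positivity)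
      obtain ⟨Z, hZY, hZ⟩ := exists_subset_card_eq this
      exact ⟨Z, hZY.trans hYX, hY.mono (by exact_mod_cast hZY), hZ⟩

/-- The independent sets of `G` contained in `X`. -/
noncomputable def indepSetsIn (X : Finset V) : Finset (Finset V) :=
  X.powerset.filter (fun Y => G.IsIndepSet (Y : Set V))

theorem mem_indepSetsIn {X Y : Finset V} :
    Y ∈ G.indepSetsIn X ↔ Y ⊆ X ∧ G.IsIndepSet (Y : Set V) := by
  simp [indepSetsIn]

/-- Each `k ^ R`-subset contains an independent `k`-set; a given `k`-set `Y` is picked by at most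
`#X ^ (k ^ R - k)` subsets `U`, as `U \ Y` determines `U`. -/
theorem choose_le_card_indepSetsIn_mul {R : ℕ} (hG : G.CliqueFree R) (k : ℕ) (X : Finset V) :
    (#X).choose (k ^ R) ≤
      #((G.indepSetsIn X).filter (fun Y => #Y = k)) * #X ^ (k ^ R - k) := by
  have hex : ∀ U : Finset V, ∃ Y, U ∈ powersetCard (k ^ R) X →
      Y ⊆ U ∧ G.IsIndepSet (Y : Set V) ∧ #Y = k := by
    intro U
    by_cases hU : U ∈ powersetCard (k ^ R) X
    · obtain ⟨Y, hY⟩ := G.exists_isIndepSet_of_pow_le_card R k U (fun T _ => hG T)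
        (mem_powersetCard.1 hU).2.ge
      exact ⟨Y, fun _ => hY⟩
    · exact ⟨∅, fun h => absurd h hU⟩
  choose φ hφ using hex
  rw [← card_powersetCard, mul_comm]
  refine card_le_mul_card_image_of_maps_to (f := φ) (fun U hU => ?_) _ (fun Y hY => ?_)
  · obtain ⟨h1, h2, h3⟩ := hφ U hU
    exact mem_filter.2 ⟨(G.mem_indepSetsIn).2 ⟨h1.trans (mem_powersetCard.1 hU).1, h2⟩, h3⟩
  · have hYk := (mem_filter.1 hY).2
    calc #((powersetCard (k ^ R) X).filter (fun U => φ U = Y))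
        ≤ #(powersetCard (k ^ R - k) X) := by
          refine card_le_card_of_injOn (fun U => U \ Y) (fun U hU => ?_) (fun U hU U' hU' h => ?_)
          · obtain ⟨hUX, rfl⟩ := mem_filter.1 hU
            obtain ⟨h1, h2, h3⟩ := hφ U hUX
            have := mem_powersetCard.1 hUX
            refine mem_powersetCard.2 ⟨sdiff_subset.trans this.1, ?_⟩
            rw [card_sdiff_of_subset h1, this.2, h3]
          · obtain ⟨hUX, e⟩ := mem_filter.1 hU
            obtain ⟨hUX', e'⟩ := mem_filter.1 hU'
            have h1 := (hφ U hUX).1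
            have h2 := (hφ U' hUX').1
            rw [e] at h1
            rw [e'] at h2
            rw [← sdiff_union_of_subset h1, ← sdiff_union_of_subset h2]
            simp only at h
            rw [h]
      _ ≤ _ := by
          rw [card_powersetCard]
          exact Nat.choose_le_pow _ _

theorem two_pow_le_card_indepSetsIn {X Y : Finset V} (hYX : Y ⊆ X) (hY : G.IsIndepSet (Y : Set V)) :
    2 ^ #Y ≤ #(G.indepSetsIn X) := by
  rw [← card_powerset]
  refine card_le_card (fun Z hZ => ?_)
  have := mem_powerset.1 hZ
  exact (G.mem_indepSetsIn).2 ⟨this.trans hYX, hY.mono (by exact_mod_cast this)⟩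

theorem card_filter_card_le_indepSetsIn (X : Finset V) (m : ℕ) :
    #((G.indepSetsIn X).filter (fun Y => #Y ≤ m)) ≤ (m + 1) * (#X + 1) ^ m := by
  calc #((G.indepSetsIn X).filter (fun Y => #Y ≤ m))
      ≤ #((range (m + 1)).biUnion (fun i => powersetCard i X)) := by
        refine card_le_card (fun Y hY => ?_)
        obtain ⟨h1, h2⟩ := mem_filter.1 hY
        exact mem_biUnion.2 ⟨#Y, by simpa [Nat.lt_succ_iff] using h2,
          mem_powersetCard.2 ⟨((G.mem_indepSetsIn).1 h1).1, rfl⟩⟩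
    _ ≤ #(range (m + 1)) * (#X + 1) ^ m := by
        refine card_biUnion_le_card_mul _ _ _ (fun i hi => ?_)
        rw [card_powersetCard]
        calc (#X).choose i ≤ #X ^ i := Nat.choose_le_pow _ _
          _ ≤ (#X + 1) ^ i := Nat.pow_le_pow_left (Nat.le_succ _) _
          _ ≤ (#X + 1) ^ m := Nat.pow_le_pow_right (Nat.succ_pos _)
            (Nat.lt_succ_iff.1 (mem_range.1 hi))
    _ = _ := by rw [card_range]

theorem _root_.Nat.exists_forall_mul_pow_le_two_pow (a b : ℕ) :
    ∃ k₀ : ℕ, ∀ k ≥ k₀, a * (k + 1) ^ b ≤ 2 ^ k := by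
  have h := tendsto_pow_const_div_const_pow_of_one_lt b (r := (2 : ℝ)) (by norm_num)
  have h2 := h.eventually (gt_mem_nhds (show (0 : ℝ) < 1 / (2 * (a + 1)) by positivity))
  obtain ⟨N, hN⟩ := Filter.eventually_atTop.1 h2
  refine ⟨N, fun k hk => ?_⟩
  have := hN (k + 1) (by omega)
  rw [div_lt_div_iff₀ (by positivity) (by positivity), pow_succ (2 : ℝ)] at this
  have h3 : (a : ℝ) * (k + 1) ^ b ≤ 2 ^ k := by
    push_cast at this
    have : (0 : ℝ) ≤ ((k : ℝ) + 1) ^ b := by positivity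
    nlinarith
  exact_mod_cast h3

/-- For small `X` the term `t` suffices. For large `X`, Ramsey gives exponentially many independent
sets in a power of `#X`, whereas only polynomially many have at most `4 * s` elements; so at least
half are larger, and these alone contribute enough. -/
theorem exists_forall_le_add_sum_card_indepSetsIn (R s : ℕ) : ∃ t₀ : ℕ, ∀ {V : Type*}
    (G : SimpleGraph V), G.CliqueFree R → ∀ t ≥ t₀, ∀ X : Finset V,
      s * (#(G.indepSetsIn X) + 1) ≤ t + ∑ Y ∈ G.indepSetsIn X, #Y := by
  set m := 4 * s with hm
  obtain ⟨k₀, hk₀⟩ := Nat.exists_forall_mul_pow_le_two_pow (2 * (m + 1)) (R * m)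
  refine ⟨s * (2 ^ (k₀ + 1) ^ R + 1), fun {V} G hG t ht X => ?_⟩
  by_cases hx : #X < (k₀ + 1) ^ R
  · have h1 : #(G.indepSetsIn X) ≤ 2 ^ (k₀ + 1) ^ R := by
      calc #(G.indepSetsIn X) ≤ #X.powerset := card_filter_le _ _
        _ = 2 ^ #X := card_powerset _
        _ ≤ _ := Nat.pow_le_pow_right (by norm_num) hx.le
    calc s * (#(G.indepSetsIn X) + 1) ≤ s * (2 ^ (k₀ + 1) ^ R + 1) := by gcongr
      _ ≤ t := ht
      _ ≤ _ := Nat.le_add_right _ _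
  · push Not at hx
    have hR : R ≠ 0 := by
      rintro rfl
      exact hG ∅ (by simp [isNClique_iff])
    -- `k` will be the integer `R`-th root of `#X`, rounded down.
    have hex : ∃ n, #X < n ^ R := ⟨#X + 1, lt_of_lt_of_le (Nat.lt_succ_self _)
      (Nat.le_self_pow hR _)⟩
    obtain ⟨k, hkk⟩ : ∃ k, Nat.find hex = k + 1 := by
      refine Nat.exists_eq_succ_of_ne_zero (fun h => ?_)
      have := Nat.find_spec hex
      rw [h, zero_pow hR] at this
      omega
    have hlt : #X < (k + 1) ^ R := hkk ▸ Nat.find_spec hex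
    have hle : k ^ R ≤ #X := by
      have := Nat.find_min hex (m := k) (by omega)
      omega
    have hk : k₀ ≤ k := by
      by_contra h
      have : (k + 1) ^ R ≤ (k₀ + 1) ^ R := Nat.pow_le_pow_left (by omega) _
      omega
    obtain ⟨Y, hYX, hY, hYc⟩ := G.exists_isIndepSet_of_pow_le_card R k X (fun T _ => hG T) hle
    have hI := G.two_pow_le_card_indepSetsIn hYX hY
    rw [hYc] at hI
    set I := G.indepSetsIn X with hIdef
    have h2 := hk₀ k hk
    have h3 : 2 * #(I.filter (fun Y => #Y ≤ m)) ≤ #I := by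
      calc 2 * #(I.filter (fun Y => #Y ≤ m)) ≤ 2 * ((m + 1) * (#X + 1) ^ m) := by
            gcongr; exact G.card_filter_card_le_indepSetsIn X m
        _ ≤ 2 * ((m + 1) * ((k + 1) ^ R) ^ m) := by gcongr; omega
        _ = 2 * (m + 1) * (k + 1) ^ (R * m) := by rw [pow_mul]; ring
        _ ≤ #I := h2.trans hI
    have h4 := card_filter_add_card_filter_not (s := I) (fun Y => #Y ≤ m)
    have h5 : #(I.filter (fun Y => ¬ #Y ≤ m)) * m ≤ ∑ Y ∈ I, #Y := by
      calc #(I.filter (fun Y => ¬ #Y ≤ m)) * m = ∑ Y ∈ I.filter (fun Y => ¬ #Y ≤ m), m := by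
            rw [sum_const, smul_eq_mul]
        _ ≤ ∑ Y ∈ I.filter (fun Y => ¬ #Y ≤ m), #Y :=
            sum_le_sum (fun Y hY => (not_le.1 (mem_filter.1 hY).2).le)
        _ ≤ _ := sum_le_sum_of_subset (filter_subset _ _)
    have h6 : 0 < #I := lt_of_lt_of_le (by positivity) hI
    have h7 : #I ≤ 2 * #(I.filter (fun Y => ¬ #Y ≤ m)) := by omega
    have h8 : s * (#I + 1) ≤ #(I.filter (fun Y => ¬ #Y ≤ m)) * m := by
      calc s * (#I + 1) ≤ s * (#(I.filter (fun Y => ¬ #Y ≤ m)) * 4) := by gcongr; omega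
        _ = _ := by rw [hm]; ring
    omega

end SimpleGraph

/-! ### Large independent sets in clique-free graphs of bounded degree -/

namespace SimpleGraph

variable {V : Type*} (G : SimpleGraph V)

theorem mem_indepSetsIn_iff_forall_not_adj {X Y : Finset V} :
    Y ∈ G.indepSetsIn X ↔ Y ⊆ X ∧ ∀ a ∈ Y, ∀ b ∈ Y, ¬ G.Adj a b := by
  rw [mem_indepSetsIn]
  refine and_congr_right (fun _ => ⟨fun h a ha b hb hab => h ha hb hab.ne hab,
    fun h a ha b hb _ => h a ha b hb⟩)

/-- Once the part `T` outside the closed neighbourhood of `v` is fixed, only two continuations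
exist: add `v` alone, or add an independent set of neighbours of `v` that have no neighbour in `T`.
-/
theorem filter_indepSetsIn_eq_insert {B T : Finset V} {v : V} (hv : v ∈ B)
    (hT : T ∈ G.indepSetsIn B) (hTv : ∀ u ∈ T, u ≠ v ∧ ¬ G.Adj v u) :
    (G.indepSetsIn B).filter (fun W => W.filter (fun u => u ≠ v ∧ ¬ G.Adj v u) = T) =
      insert (insert v T) ((G.indepSetsIn
        (B.filter (fun u => G.Adj v u ∧ ∀ w ∈ T, ¬ G.Adj u w))).image (fun Y => T ∪ Y)) := by
  rw [mem_indepSetsIn_iff_forall_not_adj] at hT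
  obtain ⟨hTB, hTi⟩ := hT
  ext W
  simp only [mem_filter, mem_insert, mem_image, mem_indepSetsIn_iff_forall_not_adj]
  constructor
  · rintro ⟨⟨hWB, hW⟩, rfl⟩
    by_cases hvW : v ∈ W
    · left
      ext u
      simp only [mem_insert, mem_filter]
      have := hW v hvW u
      by_cases huv : u = v
      · simp [huv, hvW]
      · tauto
    · right
      refine ⟨W.filter (G.Adj v), ⟨fun u hu => ?_, fun a ha b hb => ?_⟩, ?_⟩
      · obtain ⟨hu, huv⟩ := mem_filter.1 hu
        exact mem_filter.2 ⟨hWB hu, huv, fun w hw => hW u hu w (mem_filter.1 hw).1⟩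
      · exact hW a (mem_filter.1 ha).1 b (mem_filter.1 hb).1
      · ext u
        simp only [mem_union, mem_filter]
        by_cases huv : u = v
        · simp [huv, hvW]
        · tauto
  · rintro (rfl | ⟨Y, ⟨hYX, hY⟩, rfl⟩)
    · refine ⟨⟨insert_subset hv hTB, fun a ha b hb => ?_⟩, ?_⟩
      · rcases mem_insert.1 ha with rfl | haT <;> rcases mem_insert.1 hb with rfl | hbT
        · exact G.irrefl
        · exact (hTv b hbT).2
        · exact fun h => (hTv a haT).2 h.symm
        · exact hTi a haT b hbT
      · ext u
        simp only [mem_filter, mem_insert]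
        have := hTv u
        tauto
    · refine ⟨⟨union_subset hTB (hYX.trans (filter_subset _ _)), fun a ha b hb => ?_⟩, ?_⟩
      · rcases mem_union.1 ha with ha | ha <;> rcases mem_union.1 hb with hb | hb
        · exact hTi a ha b hb
        · exact fun h => (mem_filter.1 (hYX hb)).2.2 a ha h.symm
        · exact (mem_filter.1 (hYX ha)).2.2 b hb
        · exact hY a ha b hb
      · ext u
        simp only [mem_filter, mem_union]
        have h1 := hTv u
        have h2 : u ∈ Y → G.Adj v u := fun h => (mem_filter.1 (hYX h)).2.1
        tauto

/-- A uniformly random independent set either contains `v` often or meets its neighbourhood in many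
vertices. Conditioned on `T`, there are `#(G.indepSetsIn X) + 1` outcomes, and `ht` is precisely the
bound needed in that fibre. -/
theorem le_sum_indepSetsIn {s t : ℕ}
    (ht : ∀ X : Finset V, s * (#(G.indepSetsIn X) + 1) ≤ t + ∑ Y ∈ G.indepSetsIn X, #Y)
    {B : Finset V} {v : V} (hv : v ∈ B) :
    s * #(G.indepSetsIn B) ≤
      ∑ W ∈ G.indepSetsIn B, ((if v ∈ W then t else 0) + #(W.filter (G.Adj v))) := by
  set φ : Finset V → Finset V := fun W => W.filter (fun u => u ≠ v ∧ ¬ G.Adj v u) with hφ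
  have hmaps : ∀ W ∈ G.indepSetsIn B, φ W ∈ (G.indepSetsIn B).image φ :=
    fun W hW => mem_image_of_mem _ hW
  rw [card_eq_sum_card_fiberwise hmaps, ← sum_fiberwise_of_maps_to hmaps, mul_sum]
  refine sum_le_sum (fun T hT => ?_)
  obtain ⟨W, hW, rfl⟩ := mem_image.1 hT
  have hTB : φ W ∈ G.indepSetsIn B := by
    rw [mem_indepSetsIn_iff_forall_not_adj] at hW ⊢
    exact ⟨(filter_subset _ _).trans hW.1,
      fun a ha b hb => hW.2 a (mem_filter.1 ha).1 b (mem_filter.1 hb).1⟩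
  have hTv : ∀ u ∈ φ W, u ≠ v ∧ ¬ G.Adj v u := fun u hu => (mem_filter.1 hu).2
  set T := φ W with hTdef
  rw [G.filter_indepSetsIn_eq_insert hv hTB hTv]
  set X := B.filter (fun u => G.Adj v u ∧ ∀ w ∈ T, ¬ G.Adj u w) with hX
  have hadj : ∀ Y ∈ G.indepSetsIn X, (T ∪ Y).filter (G.Adj v) = Y := by
    intro Y hY
    ext u
    have h1 := hTv u
    have h2 : u ∈ Y → G.Adj v u :=
      fun h => (mem_filter.1 (((G.mem_indepSetsIn).1 hY).1 h)).2.1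
    simp only [mem_filter, mem_union]
    tauto
  have hvT : v ∉ T := fun h => (hTv v h).1 rfl
  have hnot : insert v T ∉ (G.indepSetsIn X).image (fun Y => T ∪ Y) := by
    intro h
    obtain ⟨Y, hY, he⟩ := mem_image.1 h
    have hvY : v ∈ T ∪ Y := by
      have : v ∈ insert v T := mem_insert_self _ _
      rwa [← he] at this
    rcases mem_union.1 hvY with h | h
    · exact hvT h
    · exact G.irrefl (mem_filter.1 (((G.mem_indepSetsIn).1 hY).1 h)).2.1
  have hinj : Set.InjOn (fun Y => T ∪ Y) (G.indepSetsIn X : Set (Finset V)) := by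
    intro Y hY Y' hY' h
    rw [← hadj Y hY, ← hadj Y' hY']
    simp only at h
    rw [h]
  rw [card_insert_of_notMem hnot, card_image_of_injOn hinj, sum_insert hnot, sum_image hinj]
  refine (ht X).trans (add_le_add ?_ (sum_le_sum (fun Y hY => ?_)))
  · simp
  · rw [hadj Y hY]
    exact Nat.le_add_left _ _

/-- Sum the local bound over `v`: each vertex of `W` is counted `t` times as a member and at most
`t` times as a neighbour. Some `W` does at least as well as the average. -/
theorem exists_isIndepSet_mul_card_le {s t : ℕ}
    (ht : ∀ X : Finset V, s * (#(G.indepSetsIn X) + 1) ≤ t + ∑ Y ∈ G.indepSetsIn X, #Y)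
    {B : Finset V} (hB : ∀ v ∈ B, #(B.filter (G.Adj v)) ≤ t) :
    ∃ Y ⊆ B, (∀ a ∈ Y, ∀ b ∈ Y, ¬ G.Adj a b) ∧ s * #B ≤ 2 * t * #Y := by
  have h1 : #B * (s * #(G.indepSetsIn B)) ≤ ∑ W ∈ G.indepSetsIn B, 2 * t * #W := by
    calc #B * (s * #(G.indepSetsIn B)) = ∑ v ∈ B, s * #(G.indepSetsIn B) := by
          rw [sum_const, smul_eq_mul]
      _ ≤ ∑ v ∈ B, ∑ W ∈ G.indepSetsIn B, ((if v ∈ W then t else 0) + #(W.filter (G.Adj v))) :=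
          sum_le_sum (fun v hv => G.le_sum_indepSetsIn ht hv)
      _ = ∑ W ∈ G.indepSetsIn B, ∑ v ∈ B, ((if v ∈ W then t else 0) + #(W.filter (G.Adj v))) :=
          sum_comm
      _ ≤ _ := by
          refine sum_le_sum (fun W hW => ?_)
          have hWB := ((G.mem_indepSetsIn).1 hW).1
          rw [sum_add_distrib, ← sum_filter, sum_const, smul_eq_mul, filter_mem_eq_inter,
            inter_eq_right.2 hWB]
          have h2 : ∑ v ∈ B, #(W.filter (G.Adj v)) ≤ #W * t := by
            have h3 := sum_card_bipartiteAbove_eq_sum_card_bipartiteBelow (s := B) (t := W) G.Adj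
            simp only [bipartiteAbove, bipartiteBelow] at h3
            rw [h3]
            refine sum_le_card_nsmul _ _ _ (fun w hw => ?_)
            simp_rw [G.adj_comm _ w]
            exact hB w (hWB hw)
          linarith
  have hne : (G.indepSetsIn B).Nonempty :=
    ⟨∅, (G.mem_indepSetsIn_iff_forall_not_adj).2 (by simp)⟩
  have h2 : ∑ W ∈ G.indepSetsIn B, s * #B ≤ ∑ W ∈ G.indepSetsIn B, 2 * t * #W := by
    rw [sum_const, smul_eq_mul]
    linarith
  obtain ⟨W, hW, h⟩ := exists_le_of_sum_le hne h2
  obtain ⟨hWB, hWi⟩ := (G.mem_indepSetsIn_iff_forall_not_adj).1 hW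
  exact ⟨W, hWB, hWi, h⟩

/-! ### Degeneracy and subgraphs of large minimum degree -/

/-- Remove a vertex of low degree, point it at all its remaining neighbours, and recurse. -/
theorem exists_bounded_orientation (D : ℕ) (W : Finset V)
    (hW : ∀ X ⊆ W, X.Nonempty → ∃ v ∈ X, #(X.filter (G.Adj v)) ≤ D) :
    ∃ P : V → Finset V, (∀ v, P v ⊆ W.filter (G.Adj v)) ∧ (∀ v, #(P v) ≤ D) ∧
      ∀ u ∈ W, ∀ v ∈ W, G.Adj u v → u ∈ P v ∨ v ∈ P u := by
  induction W using Finset.strongInduction with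
  | H W ih =>
    rcases W.eq_empty_or_nonempty with rfl | hne
    · exact ⟨fun _ => ∅, by simp⟩
    · obtain ⟨x, hx, hxD⟩ := hW W Subset.rfl hne
      obtain ⟨P, hP1, hP2, hP3⟩ := ih (W.erase x) (erase_ssubset hx)
        (fun X hX => hW X (hX.trans (erase_subset _ _)))
      refine ⟨Function.update P x (W.filter (G.Adj x)), fun v => ?_, fun v => ?_,
        fun u hu v hv huv => ?_⟩
      · rcases eq_or_ne v x with rfl | h
        · simp
        · rw [Function.update_of_ne h]
          exact (hP1 v).trans (filter_subset_filter _ (erase_subset _ _))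
      · rcases eq_or_ne v x with rfl | h
        · simpa using hxD
        · rw [Function.update_of_ne h]
          exact hP2 v
      · rcases eq_or_ne v x with rfl | h
        · left
          simp [hu, huv.symm]
        · rcases eq_or_ne u x with rfl | h'
          · right
            simp [hv, huv]
          · rw [Function.update_of_ne h, Function.update_of_ne h']
            exact hP3 u (mem_erase.2 ⟨h', hu⟩) v (mem_erase.2 ⟨h, hv⟩) huv

/-- Deleting a vertex of degree below `d` lowers the degree sum by less than `2 * d`, so the strict
inequality survives; it fails for the empty set. -/
theorem exists_subset_forall_le_degree (d : ℕ) (H : Finset V)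
    (hH : 2 * d * #H < ∑ v ∈ H, #(H.filter (G.Adj v))) :
    ∃ S ⊆ H, S.Nonempty ∧ ∀ v ∈ S, d ≤ #(S.filter (G.Adj v)) := by
  induction H using Finset.strongInduction with
  | H H ih =>
    by_cases h : ∀ v ∈ H, d ≤ #(H.filter (G.Adj v))
    · refine ⟨H, Subset.rfl, ?_, h⟩
      by_contra hne
      rw [not_nonempty_iff_eq_empty.1 hne] at hH
      simp at hH
    · push Not at h
      obtain ⟨x, hx, hxd⟩ := h
      have key : ∑ v ∈ H, #(H.filter (G.Adj v)) ≤
          ∑ v ∈ H.erase x, #((H.erase x).filter (G.Adj v)) + 2 * #(H.filter (G.Adj x)) := by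
        rw [← add_sum_erase H _ hx, two_mul, ← add_assoc, add_comm]
        gcongr
        have h1 : ∀ v ∈ H.erase x, #(H.filter (G.Adj v)) ≤
            #((H.erase x).filter (G.Adj v)) + if G.Adj x v then 1 else 0 := by
          intro v hv
          rw [← insert_erase hx, filter_insert, erase_insert (notMem_erase _ _), G.adj_comm v x]
          split_ifs
          · exact card_insert_le _ _
          · rfl
        refine (sum_le_sum h1).trans ?_
        rw [sum_add_distrib, ← sum_filter, sum_const, smul_eq_mul, mul_one]
        gcongr
        exact erase_subset _ _
      have h2 : #H = #(H.erase x) + 1 := (card_erase_add_one hx).symm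
      obtain ⟨S, hS, hS'⟩ := ih _ (erase_ssubset hx) (by rw [h2, mul_add] at hH; omega)
      exact ⟨S, hS.trans (erase_subset _ _), hS'⟩

theorem sum_card_filter_adj_le {D : ℕ} {W : Finset V} {P : V → Finset V}
    (hP : ∀ v, #(P v) ≤ D) (hWP : ∀ u ∈ W, ∀ v ∈ W, G.Adj u v → u ∈ P v ∨ v ∈ P u) :
    ∑ v ∈ W, #(W.filter (G.Adj v)) ≤ 2 * D * #W := by
  have h1 : ∀ v ∈ W, #(W.filter (G.Adj v)) ≤ #(P v) + #(W.filter (fun u => v ∈ P u)) := by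
    intro v hv
    refine (card_le_card (fun u hu => ?_)).trans (card_union_le _ _)
    obtain ⟨hu, huv⟩ := mem_filter.1 hu
    rcases hWP u hu v hv huv.symm with h | h
    · exact mem_union_left _ h
    · exact mem_union_right _ (mem_filter.2 ⟨hu, h⟩)
  have h2 : ∑ v ∈ W, #(W.filter (fun u => v ∈ P u)) ≤ #W * D := by
    have h3 := sum_card_bipartiteAbove_eq_sum_card_bipartiteBelow (s := W) (t := W)
      (fun v u => v ∈ P u)
    simp only [bipartiteAbove, bipartiteBelow] at h3
    rw [h3]
    refine sum_le_card_nsmul _ _ _ (fun u _ => (card_le_card (fun w hw => ?_)).trans (hP u))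
    exact (mem_filter.1 hw).2
  have h3 : ∑ v ∈ W, #(P v) ≤ #W * D := sum_le_card_nsmul _ _ _ (fun v _ => hP v)
  have h4 := sum_le_sum h1
  rw [sum_add_distrib] at h4
  linarith

end SimpleGraph

/-! ### The random set and its good vertices -/

/-- A uniform `g` encodes the random set `{v | g v = 0}`, which contains each vertex independently
with probability `1 / N`. -/
theorem card_filter_eq_zero_and_ne_zero {V : Type*} [Fintype V] {N : ℕ} [NeZero N]
    {U Z : Finset V} (hUZ : Disjoint U Z) :
    (#(univ.filter (fun g : V → Fin N => (∀ u ∈ U, g u = 0) ∧ ∀ z ∈ Z, g z ≠ 0)) : ℝ) =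
      N ^ Fintype.card V * ((1 / N : ℝ) ^ #U * (1 - 1 / N : ℝ) ^ #Z) := by
  have hN : (N : ℝ) ≠ 0 := by exact_mod_cast NeZero.ne N
  have h1 : univ.filter (fun g : V → Fin N => (∀ u ∈ U, g u = 0) ∧ ∀ z ∈ Z, g z ≠ 0) =
      Fintype.piFinset (fun v => if v ∈ U then {0} else if v ∈ Z then univ.erase 0 else univ) := by
    ext g
    simp only [mem_filter, mem_univ, true_and, Fintype.mem_piFinset]
    constructor
    · rintro ⟨hU, hZ⟩ v
      split_ifs with h h'
      · simpa using hU v h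
      · simpa using hZ v h'
      · simp
    · intro h
      refine ⟨fun u hu => by simpa [hu] using h u, fun z hz => ?_⟩
      simpa [hz, disjoint_right.1 hUZ hz] using h z
  rw [h1, Fintype.card_piFinset]
  have h2 : ∀ v : V, ((#(if v ∈ U then ({0} : Finset (Fin N)) else
      if v ∈ Z then univ.erase 0 else univ) : ℕ) : ℝ) =
      N * ((if v ∈ U then (1 / N : ℝ) else 1) * (if v ∈ Z then (1 - 1 / N : ℝ) else 1)) := by
    intro v
    split_ifs with h h' h'
    · exact absurd h' (disjoint_left.1 hUZ h)
    · simp [hN]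
    · rw [card_erase_of_mem (mem_univ _), card_univ, Fintype.card_fin,
        Nat.cast_sub (Nat.one_le_iff_ne_zero.2 (NeZero.ne N))]
      field_simp
      simp
    · simp
  rw [Nat.cast_prod, prod_congr rfl (fun v _ => h2 v), prod_mul_distrib, prod_mul_distrib]
  simp [prod_ite_mem, prod_const]

namespace SimpleGraph

variable {V : Type*} (G : SimpleGraph V)

theorem pow_le_card_indepSetsIn_mul {R : ℕ} (hG : G.CliqueFree R) (k : ℕ) {X : Finset V}
    (hkR : k ≤ k ^ R) (hX : 2 * k ^ R ≤ #X) (hX0 : 0 < #X) :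
    (#X : ℝ) ^ k ≤ #((G.indepSetsIn X).filter (fun Y => #Y = k)) * (2 * k ^ R : ℝ) ^ k ^ R := by
  have h1 := G.choose_le_card_indepSetsIn_mul hG k X
  set M := k ^ R with hM
  set I := #((G.indepSetsIn X).filter (fun Y => #Y = k))
  have h2 : (#X) ^ M ≤ 2 ^ M * (M ^ M * (#X).choose M) := by
    -- Since `2 * M ≤ #X`, each factor of the descending factorial is at least `#X / 2`.
    calc (#X) ^ M ≤ (2 * (#X + 1 - M)) ^ M := Nat.pow_le_pow_left (by omega) _
      _ = 2 ^ M * (#X + 1 - M) ^ M := mul_pow _ _ _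
      _ ≤ 2 ^ M * (M.factorial * (#X).choose M) := by
          gcongr
          rw [← Nat.descFactorial_eq_factorial_mul_choose]
          exact Nat.pow_sub_le_descFactorial _ _
      _ ≤ _ := by
          gcongr
          exact Nat.factorial_le_pow M
  have h3 : (#X) ^ k * (#X) ^ (M - k) ≤ I * (2 * M) ^ M * (#X) ^ (M - k) := by
    rw [← pow_add, Nat.add_sub_cancel' hkR]
    calc (#X) ^ M ≤ 2 ^ M * (M ^ M * (#X).choose M) := h2
      _ ≤ 2 ^ M * (M ^ M * (I * (#X) ^ (M - k))) := by gcongr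
      _ = _ := by rw [mul_pow]; ring
  have h4 := Nat.le_of_mul_le_mul_right h3 (by positivity)
  have h5 : (M : ℝ) = (k : ℝ) ^ R := by rw [hM]; push_cast; rfl
  rw [← h5]
  exact_mod_cast h4

/-- The set `U` of neighbours of `v` in `A` has `k` elements, all related to `v` by `Q`, the vertex
`v` is not in `A`, and no out-neighbour (under the orientation `P`) of an element of `U`
is in `A`. -/
def IsGoodFor (P : V → Finset V) (Q : V → V → Prop) (k : ℕ) (A : Finset V) (v : V) : Prop :=
  v ∉ A ∧ #(A.filter (G.Adj v)) = k ∧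
    ∀ u ∈ A, G.Adj v u → Q v u ∧ Disjoint (P u) A

theorem one_half_pow_le_one_sub_pow {e z m : ℕ} (he : 0 < e) (hz : z ≤ m * e) :
    (1 / 2 : ℝ) ^ m ≤ (1 - 1 / ((4 * e : ℕ) : ℝ)) ^ z := by
  have he' : (1 : ℝ) ≤ e := by exact_mod_cast he
  have h0 : (1 : ℝ) / ((4 * e : ℕ) : ℝ) ≤ 1 / 4 := by
    push_cast
    rw [div_le_div_iff₀ (by positivity) (by norm_num)]
    linarith
  have h0' : (0 : ℝ) ≤ 1 / ((4 * e : ℕ) : ℝ) := by positivity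
  -- Bernoulli's inequality even gives `3 / 4`.
  have h1 : (1 / 2 : ℝ) ≤ (1 - 1 / ((4 * e : ℕ) : ℝ)) ^ e := by
    have h2 := one_add_mul_le_pow (a := -(1 / ((4 * e : ℕ) : ℝ))) (by linarith) e
    have h3 : (e : ℝ) * (1 / ((4 * e : ℕ) : ℝ)) = 1 / 4 := by
      push_cast
      field_simp
    rw [← sub_eq_add_neg] at h2
    linarith
  calc (1 / 2 : ℝ) ^ m ≤ ((1 - 1 / ((4 * e : ℕ) : ℝ)) ^ e) ^ m := by gcongr
    _ = (1 - 1 / ((4 * e : ℕ) : ℝ)) ^ (m * e) := by rw [← pow_mul, mul_comm e m]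
    _ ≤ _ := pow_le_pow_of_le_one (by linarith) (by linarith) hz

/-- The events "the neighbours of `v` in the random set are exactly `U`", for independent `k`-sets
`U` of suitable neighbours, are disjoint. There are of order `e ^ k` of them, each of probability of
order `e ^ (-k)`. -/
theorem le_card_filter_isGoodFor [Fintype V] {R k e : ℕ} [NeZero (4 * e)] (hG : G.CliqueFree R)
    (hkR : k ≤ k ^ R) (hk : 0 < k) (he : 2 * k ^ R ≤ e) {W : Finset V} {P : V → Finset V}
    (hPW : ∀ v, P v ⊆ W.filter (G.Adj v)) (hP : ∀ v, #(P v) ≤ 2 * e) (Q : V → V → Prop)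
    {v : V} (hv1 : #(W.filter (G.Adj v)) ≤ 8 * e)
    (hv2 : e ≤ #(W.filter (fun u => G.Adj v u ∧ Q v u))) :
    (((4 * e : ℕ) : ℝ) ^ Fintype.card V) *
        ((1 / 4) ^ k * (1 / (2 * k ^ R)) ^ k ^ R * (1 / 2) ^ (2 * k + 9)) ≤
      #(univ.filter (fun g : V → Fin (4 * e) =>
        G.IsGoodFor P Q k (W.filter (fun u => g u = 0)) v)) := by
  have hepos : 0 < e := lt_of_lt_of_le (by positivity) he
  obtain ⟨X, hX, hXe⟩ := exists_subset_card_eq hv2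
  set I := (G.indepSetsIn X).filter (fun Y => #Y = k) with hI
  have hIcard := G.pow_le_card_indepSetsIn_mul hG k hkR (hXe ▸ he) (hXe ▸ hepos)
  rw [hXe] at hIcard
  -- The vertices the random set must avoid for `U` to witness that `v` is good. Removing `U` loses
  -- no constraint, since `U` is independent and excludes `v`.
  set Z : Finset V → Finset V :=
    fun U => (insert v (W.filter (G.Adj v)) ∪ U.biUnion P) \ U with hZ
  set F : Finset V → Finset (V → Fin (4 * e)) :=
    fun U => univ.filter (fun g => (∀ u ∈ U, g u = 0) ∧ ∀ z ∈ Z U, g z ≠ 0) with hF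
  have hmemI : ∀ U ∈ I, U ⊆ X ∧ (∀ a ∈ U, ∀ b ∈ U, ¬ G.Adj a b) ∧ #U = k := by
    intro U hU
    obtain ⟨h1, h2⟩ := mem_filter.1 hU
    obtain ⟨h3, h4⟩ := (G.mem_indepSetsIn_iff_forall_not_adj).1 h1
    exact ⟨h3, h4, h2⟩
  have hnb : ∀ U ∈ I, ∀ g ∈ F U,
      (W.filter (fun u => g u = 0)).filter (G.Adj v) = U := by
    intro U hU g hg
    obtain ⟨h1, h2⟩ := (mem_filter.1 hg).2
    obtain ⟨h3, -, -⟩ := hmemI U hU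
    ext u
    simp only [mem_filter]
    constructor
    · rintro ⟨⟨huW, hu0⟩, huv⟩
      by_contra hu
      exact h2 u (mem_sdiff.2 ⟨mem_union_left _ (mem_insert_of_mem (mem_filter.2 ⟨huW, huv⟩)), hu⟩)
        hu0
    · intro hu
      have := mem_filter.1 (hX (h3 hu))
      exact ⟨⟨this.1, h1 u hu⟩, this.2.1⟩
  have hgood : ∀ U ∈ I, ∀ g ∈ F U,
      G.IsGoodFor P Q k (W.filter (fun u => g u = 0)) v := by
    intro U hU g hg
    have h0 := hnb U hU g hg
    obtain ⟨h1, h2⟩ := (mem_filter.1 hg).2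
    obtain ⟨h3, h4, h5⟩ := hmemI U hU
    refine ⟨fun hv => ?_, by rw [h0, h5], fun u hu huv => ?_⟩
    · refine h2 v (mem_sdiff.2 ⟨mem_union_left _ (mem_insert_self _ _), fun hvU => ?_⟩)
        (mem_filter.1 hv).2
      exact G.irrefl (mem_filter.1 (hX (h3 hvU))).2.1
    · have huU : u ∈ U := h0 ▸ mem_filter.2 ⟨hu, huv⟩
      refine ⟨(mem_filter.1 (hX (h3 huU))).2.2, Finset.disjoint_left.2 (fun w hwP hw => ?_)⟩
      refine h2 w (mem_sdiff.2 ⟨mem_union_right _ (mem_biUnion.2 ⟨u, huU, hwP⟩), fun hwU => ?_⟩)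
        (mem_filter.1 hw).2
      exact h4 u huU w hwU (mem_filter.1 (hPW u hwP)).2
  have hdisj : (I : Set (Finset V)).PairwiseDisjoint F := by
    intro U hU U' hU' hne
    refine Finset.disjoint_left.2 (fun g hg hg' => hne ?_)
    rw [← hnb U hU g hg, ← hnb U' hU' g hg']
  -- At most `1 + 8 * e` vertices from `v` and its neighbours, and `2 * e` for each element of `U`.
  have hZcard : ∀ U ∈ I, #(Z U) ≤ (2 * k + 9) * e := by
    intro U hU
    obtain ⟨-, -, h5⟩ := hmemI U hU
    have h1 : #(U.biUnion P) ≤ #U * (2 * e) := card_biUnion_le_card_mul _ _ _ (fun u _ => hP u)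
    have h2 := card_insert_le v (W.filter (G.Adj v))
    have h3 : #(Z U) ≤ _ := (card_le_card sdiff_subset).trans (card_union_le _ _)
    rw [h5] at h1
    nlinarith
  have hFcard : ∀ U ∈ I, ((4 * e : ℕ) : ℝ) ^ Fintype.card V *
      ((1 / ((4 * e : ℕ) : ℝ)) ^ k * (1 / 2) ^ (2 * k + 9)) ≤ #(F U) := by
    intro U hU
    obtain ⟨-, -, h5⟩ := hmemI U hU
    rw [hF, card_filter_eq_zero_and_ne_zero disjoint_sdiff, h5]
    gcongr
    exact one_half_pow_le_one_sub_pow hepos (hZcard U hU)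
  have hsum : (#I : ℝ) * (((4 * e : ℕ) : ℝ) ^ Fintype.card V *
      ((1 / ((4 * e : ℕ) : ℝ)) ^ k * (1 / 2) ^ (2 * k + 9))) ≤
      #(univ.filter (fun g : V → Fin (4 * e) =>
        G.IsGoodFor P Q k (W.filter (fun u => g u = 0)) v)) := by
    have h1 : #(I.biUnion F) ≤ #(univ.filter (fun g : V → Fin (4 * e) =>
        G.IsGoodFor P Q k (W.filter (fun u => g u = 0)) v)) := by
      refine card_le_card (fun g hg => ?_)
      obtain ⟨U, hU, hgU⟩ := mem_biUnion.1 hg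
      exact mem_filter.2 ⟨mem_univ _, hgood U hU g hgU⟩
    rw [card_biUnion hdisj] at h1
    refine le_trans ?_ (Nat.cast_le.2 h1)
    push_cast
    rw [← nsmul_eq_mul]
    have := card_nsmul_le_sum I (fun U => (#(F U) : ℝ)) _ hFcard
    simpa using this
  refine le_trans ?_ hsum
  have he0 : (0 : ℝ) < e := by exact_mod_cast hepos
  have hk0 : (0 : ℝ) < k := by exact_mod_cast hk
  have hb : (0 : ℝ) < (2 * k ^ R : ℝ) ^ k ^ R := by positivity
  have key : (1 / 4 : ℝ) ^ k * (1 / (2 * k ^ R)) ^ k ^ R ≤ #I * (1 / ((4 * e : ℕ) : ℝ)) ^ k := by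
    rw [one_div_pow, one_div_pow, one_div_pow]
    push_cast
    rw [mul_pow (4 : ℝ) (e : ℝ), one_div_mul_one_div, mul_one_div,
      div_le_div_iff₀ (by positivity) (by positivity)]
    have : (0 : ℝ) < 4 ^ k := by positivity
    nlinarith
  calc _ = ((4 * e : ℕ) : ℝ) ^ Fintype.card V *
        (((1 / 4 : ℝ) ^ k * (1 / (2 * k ^ R)) ^ k ^ R) * (1 / 2) ^ (2 * k + 9)) := by ring
    _ ≤ ((4 * e : ℕ) : ℝ) ^ Fintype.card V *
        ((#I * (1 / ((4 * e : ℕ) : ℝ)) ^ k) * (1 / 2) ^ (2 * k + 9)) := by gcongr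
    _ = _ := by ring

theorem exists_card_filter_isGoodFor [Fintype V] {R k e : ℕ} (hG : G.CliqueFree R)
    (hkR : k ≤ k ^ R) (hk : 0 < k) (he : 2 * k ^ R ≤ e) {W S : Finset V} {P : V → Finset V}
    (hPW : ∀ v, P v ⊆ W.filter (G.Adj v)) (hP : ∀ v, #(P v) ≤ 2 * e) (Q : V → V → Prop)
    (hW : W.Nonempty) (hS : #W ≤ 4 * #S)
    (hS1 : ∀ v ∈ S, #(W.filter (G.Adj v)) ≤ 8 * e)
    (hS2 : ∀ v ∈ S, e ≤ #(W.filter (fun u => G.Adj v u ∧ Q v u))) :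
    ∃ A ⊆ W, ((1 / 4) ^ k * (1 / (2 * k ^ R)) ^ k ^ R * (1 / 2) ^ (2 * k + 9)) * e / 2 * #A <
      (#(S.filter (G.IsGoodFor P Q k A)) : ℝ) := by
  have hepos : 0 < e := lt_of_lt_of_le (by positivity) he
  have : NeZero (4 * e) := ⟨by omega⟩
  set c : ℝ := (1 / 4) ^ k * (1 / (2 * k ^ R)) ^ k ^ R * (1 / 2) ^ (2 * k + 9) with hc
  have hk0 : (0 : ℝ) < k := by exact_mod_cast hk
  have hcpos : 0 < c := by positivity
  have he0 : (0 : ℝ) < e := by exact_mod_cast hepos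
  set Ω : ℝ := ((4 * e : ℕ) : ℝ) ^ Fintype.card V with hΩ
  have hΩpos : 0 < Ω := by positivity
  have hB : Ω * c * #S ≤ ∑ g : V → Fin (4 * e),
      (#(S.filter (G.IsGoodFor P Q k (W.filter (fun u => g u = 0)))) : ℝ) := by
    have h1 := sum_card_bipartiteAbove_eq_sum_card_bipartiteBelow
      (s := (univ : Finset (V → Fin (4 * e)))) (t := S)
      (fun g v => G.IsGoodFor P Q k (W.filter (fun u => g u = 0)) v)
    simp only [bipartiteAbove, bipartiteBelow] at h1
    have h2 := card_nsmul_le_sum S (fun v => (#(univ.filter (fun g : V → Fin (4 * e) =>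
        G.IsGoodFor P Q k (W.filter (fun u => g u = 0)) v)) : ℝ)) (Ω * c)
        (fun v hv => G.le_card_filter_isGoodFor hG hkR hk he hPW hP Q (hS1 v hv) (hS2 v hv))
    rw [nsmul_eq_mul, mul_comm] at h2
    refine h2.trans (le_of_eq ?_)
    exact_mod_cast h1.symm
  have hA : ∑ g : V → Fin (4 * e), (#(W.filter (fun u => g u = 0)) : ℝ) =
      Ω * (1 / ((4 * e : ℕ) : ℝ)) * #W := by
    have h1 := sum_card_bipartiteAbove_eq_sum_card_bipartiteBelow
      (s := (univ : Finset (V → Fin (4 * e)))) (t := W) (fun g v => g v = 0)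
    simp only [bipartiteAbove, bipartiteBelow] at h1
    have h2 : ∀ v ∈ W, (#(univ.filter (fun g : V → Fin (4 * e) => g v = 0)) : ℝ) =
        Ω * (1 / ((4 * e : ℕ) : ℝ)) := by
      intro v _
      have := card_filter_eq_zero_and_ne_zero (N := 4 * e) (disjoint_empty_right ({v} : Finset V))
      simpa [hΩ] using this
    calc _ = ((∑ g : V → Fin (4 * e), #(W.filter (fun u => g u = 0)) : ℕ) : ℝ) := by push_cast; rfl
      _ = ∑ v ∈ W, (#(univ.filter (fun g : V → Fin (4 * e) => g v = 0)) : ℝ) := by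
        rw [h1]; push_cast; rfl
      _ = _ := by rw [sum_congr rfl h2, sum_const, nsmul_eq_mul, mul_comm]
  have hlt : ∑ g : V → Fin (4 * e), c * e / 2 * (#(W.filter (fun u => g u = 0)) : ℝ) <
      ∑ g : V → Fin (4 * e),
        (#(S.filter (G.IsGoodFor P Q k (W.filter (fun u => g u = 0)))) : ℝ) := by
    refine lt_of_lt_of_le ?_ hB
    rw [← mul_sum, hA]
    -- The expectations compare as `c * #W / 8 < c * #S`; the factor `1 / 2` in the statement
    -- provides the strictness.
    have hW0 : (0 : ℝ) < #W := by exact_mod_cast hW.card_pos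
    have hS' : (#W : ℝ) ≤ 4 * #S := by exact_mod_cast hS
    have : c * e / 2 * (Ω * (1 / ((4 * e : ℕ) : ℝ)) * #W) = Ω * c * (#W / 8) := by
      push_cast
      field_simp
      norm_num
    rw [this]
    have : (0 : ℝ) < Ω * c := by positivity
    gcongr
    linarith
  obtain ⟨g, -, hg⟩ := exists_lt_of_sum_lt hlt
  exact ⟨_, filter_subset _ _, hg⟩

theorem exists_isIndepSet_pair (R k : ℕ) (hR : R ≠ 0) (hk : 0 < k) : ∃ e₀ : ℕ, 0 < e₀ ∧
    ∀ {V : Type*} [Fintype V] (G : SimpleGraph V), G.CliqueFree R → ∀ e ≥ e₀,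
    ∀ (W S : Finset V) (P : V → Finset V) (Q : V → V → Prop),
    (∀ v, P v ⊆ W.filter (G.Adj v)) → (∀ v, #(P v) ≤ 2 * e) →
    (∀ u ∈ W, ∀ v ∈ W, G.Adj u v → u ∈ P v ∨ v ∈ P u) → W.Nonempty → S ⊆ W → #W ≤ 4 * #S →
    (∀ v ∈ S, #(W.filter (G.Adj v)) ≤ 8 * e) →
    (∀ v ∈ S, e ≤ #(W.filter (fun u => G.Adj v u ∧ Q v u))) →
    ∃ A ⊆ W, ∃ B ⊆ W, B.Nonempty ∧ #A ≤ #B ∧ (∀ a ∈ A, ∀ b ∈ A, ¬ G.Adj a b) ∧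
      (∀ a ∈ B, ∀ b ∈ B, ¬ G.Adj a b) ∧ (∀ v ∈ B, k ≤ #(A.filter (G.Adj v))) ∧
      ∀ v ∈ B, ∀ a ∈ A, G.Adj v a → Q v a := by
  set c : ℝ := (1 / 4) ^ k * (1 / (2 * k ^ R)) ^ k ^ R * (1 / 2) ^ (2 * k + 9) with hc
  have hk0 : (0 : ℝ) < k := by exact_mod_cast hk
  have hcpos : 0 < c := by positivity
  -- The final count is `#B > (s * c / 32) * #A'`: the factor `c * e / 2` from the good vertices
  -- times `s / (16 * e)` from the independent set.
  obtain ⟨s, hs⟩ := exists_nat_ge (32 / c)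
  have hs0 : (0 : ℝ) < s := lt_of_lt_of_le (by positivity) hs
  obtain ⟨t₀, ht₀⟩ := exists_forall_le_add_sum_card_indepSetsIn R s
  have hkR : k ≤ k ^ R := Nat.le_self_pow hR k
  refine ⟨2 * k ^ R + t₀, by positivity,
    fun {V} _ G hG e he W S P Q hPW hP hWP hW hSW hS hS1 hS2 => ?_⟩
  have he2 : 2 * k ^ R ≤ e := by omega
  have hepos : 0 < e := lt_of_lt_of_le (by positivity) he2
  have he0 : (0 : ℝ) < e := by exact_mod_cast hepos
  obtain ⟨A', hA'W, hA'⟩ := G.exists_card_filter_isGoodFor hG hkR hk he2 hPW hP Q hW hS hS1 hS2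
  rw [← hc] at hA'
  set B' := S.filter (G.IsGoodFor P Q k A') with hB'
  obtain ⟨B, hBB', hBi, hBc⟩ := G.exists_isIndepSet_mul_card_le (s := s) (t := 8 * e) (B := B')
    (fun X => ht₀ G hG (8 * e) (by omega) X) (fun v hv =>
      (card_le_card (filter_subset_filter _ ((filter_subset _ _).trans hSW))).trans
        (hS1 v (mem_filter.1 hv).1))
  have hgood : ∀ v ∈ B, G.IsGoodFor P Q k A' v := fun v hv => (mem_filter.1 (hBB' hv)).2
  have hBcR : (s : ℝ) * #B' ≤ 16 * e * #B := by
    have : s * #B' ≤ 16 * e * #B := by linarith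
    exact_mod_cast this
  have hlt : (s : ℝ) * (c * e / 2 * #A') < 16 * e * #B := by
    refine lt_of_lt_of_le ?_ hBcR
    gcongr
  have hsc : 32 ≤ s * c := (div_le_iff₀ hcpos).1 hs
  have hAB : (#A' : ℝ) < #B := by
    have h1 : 16 * e * (#A' : ℝ) ≤ s * (c * e / 2 * #A') := by
      have : (0 : ℝ) ≤ e * #A' := by positivity
      nlinarith
    have h2 := h1.trans_lt hlt
    exact lt_of_mul_lt_mul_left h2 (by positivity)
  have hAB' : #A' < #B := by exact_mod_cast hAB
  -- An edge inside the filtered set would put one end in `P` of the other. Neighbours of good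
  -- vertices all survive the filter.
  refine ⟨A'.filter (fun a => Disjoint (P a) A'), (filter_subset _ _).trans hA'W, B,
    (hBB'.trans (filter_subset _ _)).trans hSW, card_pos.1 (by omega),
    (card_filter_le _ _).trans hAB'.le, fun a ha b hb hab => ?_, hBi, fun v hv => ?_,
    fun v hv a ha hva => ?_⟩
  · obtain ⟨ha, ha'⟩ := mem_filter.1 ha
    obtain ⟨hb, hb'⟩ := mem_filter.1 hb
    rcases hWP a (hA'W ha) b (hA'W hb) hab with h | h
    · exact Finset.disjoint_left.1 hb' h ha
    · exact Finset.disjoint_left.1 ha' h hb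
  · obtain ⟨-, h2, h3⟩ := hgood v hv
    rw [← h2]
    refine card_le_card (fun u hu => ?_)
    obtain ⟨hu, hvu⟩ := mem_filter.1 hu
    exact mem_filter.2 ⟨mem_filter.2 ⟨hu, (h3 u hu hvu).2⟩, hvu⟩
  · exact ((hgood v hv).2.2 a (mem_filter.1 ha).1 hva).1

end SimpleGraph

/-! ### Assembly for oriented graphs -/

namespace Digraph

variable {V : Type*} (D : Digraph V)

theorem toSimpleGraphInclusive_adj {u v : V} :
    D.toSimpleGraphInclusive.Adj u v ↔ u ≠ v ∧ (D.Adj u v ∨ D.Adj v u) := Iff.rfl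

theorem le_minDegree_induce_iff {S : Finset V} (hS : S.Nonempty) {d : ℕ} :
    d ≤ (D.induce S).minDegree ↔
      ∀ v ∈ S, d ≤ #(S.filter (D.toSimpleGraphInclusive.Adj v)) := by
  have hcard : ∀ v : S, ∀ [Fintype ((D.induce S).toSimpleGraphInclusive.neighborSet v)],
      (D.induce S).toSimpleGraphInclusive.degree v =
        #(S.filter (D.toSimpleGraphInclusive.Adj v)) := by
    intro v _
    rw [← SimpleGraph.card_neighborFinset_eq_degree]
    refine card_bij (fun u _ => u.1) (fun u hu => ?_) (fun _ _ _ _ h => Subtype.ext h)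
      (fun u hu => ?_)
    · rw [SimpleGraph.mem_neighborFinset, toSimpleGraphInclusive_adj] at hu
      refine mem_filter.2 ⟨u.2, (toSimpleGraphInclusive_adj D).2 ⟨?_, hu.2⟩⟩
      exact fun h => hu.1 (Subtype.ext h)
    · obtain ⟨huS, huv⟩ := mem_filter.1 hu
      refine ⟨⟨u, huS⟩, ?_, rfl⟩
      rw [SimpleGraph.mem_neighborFinset, toSimpleGraphInclusive_adj]
      rw [toSimpleGraphInclusive_adj] at huv
      exact ⟨fun h => huv.1 (congrArg Subtype.val h), huv.2⟩
  have : Nonempty S := hS.to_subtype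
  unfold minDegree
  constructor
  · intro h v hv
    rw [← hcard ⟨v, hv⟩]
    exact h.trans (SimpleGraph.minDegree_le_degree _ _)
  · intro h
    refine SimpleGraph.le_minDegree_of_forall_le_degree _ _ (fun v => ?_)
    rw [hcard v]
    exact h v v.2

theorem le_card_filter_adj_of_le_minDegree [Fintype V] {d : ℕ} (h : d ≤ D.minDegree) (v : V) :
    d ≤ #(univ.filter (D.toSimpleGraphInclusive.Adj v)) := by
  unfold minDegree at h
  refine h.trans ((SimpleGraph.minDegree_le_degree _ v).trans (le_of_eq ?_))
  rw [← SimpleGraph.card_neighborFinset_eq_degree]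
  congr 1
  ext u
  simp

end Digraph

/-- By minimality every nonempty proper subset has a vertex of degree below `d`. For `W` itself,
delete one vertex: restoring it raises such a degree by at most one, to `d`. -/
theorem SimpleGraph.exists_minimal_subset_forall_le_degree {V : Type*} [Fintype V] [Nonempty V]
    (G : SimpleGraph V) {d : ℕ} (hd : 0 < d) (hG : ∀ v, d ≤ #(univ.filter (G.Adj v))) :
    ∃ W : Finset V, W.Nonempty ∧ (∀ v ∈ W, d ≤ #(W.filter (G.Adj v))) ∧
      ∀ X ⊆ W, X.Nonempty → ∃ v ∈ X, #(X.filter (G.Adj v)) ≤ d := by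
  obtain ⟨W, hW⟩ := exists_minimal (s := (univ : Finset V).powerset.filter
    (fun W => W.Nonempty ∧ ∀ v ∈ W, d ≤ #(W.filter (G.Adj v))))
    ⟨univ, mem_filter.2 ⟨by simp, univ_nonempty, fun v _ => hG v⟩⟩
  obtain ⟨hWn, hWd⟩ := (mem_filter.1 hW.prop).2
  have hprop : ∀ X ⊂ W, X.Nonempty → ∃ v ∈ X, #(X.filter (G.Adj v)) < d := by
    intro X hX hXn
    by_contra! h
    exact hX.2 (hW.le_of_le (mem_filter.2 ⟨by simp, hXn, h⟩) hX.1)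
  refine ⟨W, hWn, hWd, fun X hX hXn => ?_⟩
  rcases hX.eq_or_ssubset with rfl | hss
  · obtain ⟨x, hx⟩ := hWn
    obtain ⟨y, hy⟩ := card_pos.1 (hd.trans_le (hWd x hx))
    obtain ⟨hy, hxy⟩ := mem_filter.1 hy
    obtain ⟨v, hv, hvd⟩ := hprop (X.erase x) (erase_ssubset hx)
      ⟨y, mem_erase.2 ⟨hxy.ne.symm, hy⟩⟩
    refine ⟨v, mem_of_mem_erase hv, ?_⟩
    have h1 : X.filter (G.Adj v) ⊆ insert x ((X.erase x).filter (G.Adj v)) := by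
      intro u hu
      simp only [mem_insert, mem_filter, mem_erase] at hu ⊢
      tauto
    have h2 := (card_le_card h1).trans (card_insert_le _ _)
    omega
  · obtain ⟨v, hv, h⟩ := hprop X hss hXn
    exact ⟨v, hv, h.le⟩

/-- Markov's inequality: the average degree is at most `4 * e`. -/
theorem SimpleGraph.card_le_two_mul_card_filter_degree_le {V : Type*} (G : SimpleGraph V) {e : ℕ}
    (he : 0 < e) {W : Finset V} {P : V → Finset V} (hP : ∀ v, #(P v) ≤ 2 * e)
    (hWP : ∀ u ∈ W, ∀ v ∈ W, G.Adj u v → u ∈ P v ∨ v ∈ P u) :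
    #W ≤ 2 * #(W.filter (fun v => #(W.filter (G.Adj v)) ≤ 8 * e)) := by
  have h1 := G.sum_card_filter_adj_le hP hWP
  have h2 : #(W.filter (fun v => ¬ #(W.filter (G.Adj v)) ≤ 8 * e)) * (8 * e) ≤
      ∑ v ∈ W, #(W.filter (G.Adj v)) := by
    refine le_trans ?_ (sum_le_sum_of_subset (filter_subset
      (fun v => ¬ #(W.filter (G.Adj v)) ≤ 8 * e) W))
    exact card_nsmul_le_sum _ _ _ (fun v hv => (not_le.1 (mem_filter.1 hv).2).le)
  have h3 := card_filter_add_card_filter_not (s := W) (fun v => #(W.filter (G.Adj v)) ≤ 8 * e)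
  have h4 : #(W.filter (fun v => ¬ #(W.filter (G.Adj v)) ≤ 8 * e)) * 2 ≤ #W := by
    have : (#(W.filter (fun v => ¬ #(W.filter (G.Adj v)) ≤ 8 * e)) * 2) * (4 * e) ≤
        #W * (4 * e) := by linarith
    exact Nat.le_of_mul_le_mul_right this (by positivity)
  omega

theorem Digraph.exists_isAntidirected_of_isIndepSet_pair {V : Type*} (D : Digraph V) {d : ℕ}
    (A B : Finset V) (hB : B.Nonempty) (hAB : #A ≤ #B)
    (hAi : ∀ a ∈ A, ∀ b ∈ A, ¬ D.Adj a b) (hBi : ∀ a ∈ B, ∀ b ∈ B, ¬ D.Adj a b)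
    (hdeg : ∀ v ∈ B, 4 * d + 1 ≤ #(A.filter (D.toSimpleGraphInclusive.Adj v)))
    (hdir : (∀ v ∈ B, ∀ a ∈ A, ¬ D.Adj v a) ∨ (∀ v ∈ B, ∀ a ∈ A, ¬ D.Adj a v)) :
    ∃ S : Finset V, S.Nonempty ∧ (D.induce S).IsAntidirected ∧ d ≤ (D.induce S).minDegree := by
  obtain ⟨S, hS, hSn, hSd⟩ :=
    -- Degrees of `B` alone sum to at least `(4 * d + 1) * #B`, beating `2 * d * #(A ∪ B) ≤ 4 * d *
    -- #B`.
    D.toSimpleGraphInclusive.exists_subset_forall_le_degree d (A ∪ B) (by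
      have h1 : #B * (4 * d + 1) ≤
          ∑ v ∈ A ∪ B, #((A ∪ B).filter (D.toSimpleGraphInclusive.Adj v)) := by
        refine le_trans ?_ (sum_le_sum_of_subset (subset_union_right (s₁ := A)))
        exact card_nsmul_le_sum _ _ _ (fun v hv => (hdeg v hv).trans
          (card_le_card (filter_subset_filter _ subset_union_left)))
      have h2 := card_union_le A B
      have h3 := hB.card_pos
      have h4 : 2 * d * #(A ∪ B) ≤ 2 * d * (#B + #B) := Nat.mul_le_mul_left _ (by omega)
      linarith)
  refine ⟨S, hSn, fun v => ?_, (D.le_minDegree_induce_iff hSn).2 hSd⟩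
  have hor : (∀ u : S, ¬ D.Adj u v) ∨ (∀ u : S, ¬ D.Adj v u) := by
    rcases hdir with h | h <;> rcases mem_union.1 (hS v.2) with hv | hv
    · exact Or.inl fun u => (mem_union.1 (hS u.2)).elim (fun hu => hAi u hu v hv)
        (fun hu => h u hu v hv)
    · exact Or.inr fun u => (mem_union.1 (hS u.2)).elim (fun hu => h v hv u hu)
        (fun hu => hBi v hv u hu)
    · exact Or.inr fun u => (mem_union.1 (hS u.2)).elim (fun hu => hAi v hv u hu)
        (fun hu => h u hu v hv)
    · exact Or.inl fun u => (mem_union.1 (hS u.2)).elim (fun hu => h v hv u hu)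
        (fun hu => hBi u hu v hv)
  exact hor

theorem Digraph.exists_isAntidirected_of_cliqueFree (R d : ℕ) (hR : R ≠ 0) : ∃ m : ℕ,
    ∀ (V : Type*) [Fintype V] [Nonempty V] (D : Digraph V), D.IsOriented →
      D.toSimpleGraphInclusive.CliqueFree R → m ≤ D.minDegree →
      ∃ S : Finset V, S.Nonempty ∧ (D.induce S).IsAntidirected ∧
        d ≤ (D.induce S).minDegree := by
  obtain ⟨e, he, hpair⟩ := SimpleGraph.exists_isIndepSet_pair R (4 * d + 1) hR (Nat.succ_pos _)
  refine ⟨2 * e, fun V _ _ D hD hG hdeg => ?_⟩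
  set G := D.toSimpleGraphInclusive with hGdef
  obtain ⟨W, hWn, hWd, hWmin⟩ := G.exists_minimal_subset_forall_le_degree (d := 2 * e) (by omega)
    (D.le_card_filter_adj_of_le_minDegree hdeg)
  obtain ⟨P, hP1, hP2, hP3⟩ := G.exists_bounded_orientation (2 * e) W hWmin
  have hhalf := G.card_le_two_mul_card_filter_degree_le he hP2 hP3
  set S₀ := W.filter (fun v => #(W.filter (G.Adj v)) ≤ 8 * e) with hS₀
  set Sin := S₀.filter (fun v => e ≤ #(W.filter (fun u => G.Adj v u ∧ D.Adj u v))) with hSin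
  set Sout := S₀.filter (fun v => e ≤ #(W.filter (fun u => G.Adj v u ∧ D.Adj v u))) with hSout
  have hcover : S₀ ⊆ Sin ∪ Sout := by
    intro v hv
    have h1 : W.filter (G.Adj v) ⊆ W.filter (fun u => G.Adj v u ∧ D.Adj u v) ∪
        W.filter (fun u => G.Adj v u ∧ D.Adj v u) := by
      intro u hu
      obtain ⟨hu, huv⟩ := mem_filter.1 hu
      rcases huv.2 with h | h
      · exact mem_union_right _ (mem_filter.2 ⟨hu, huv, h⟩)
      · exact mem_union_left _ (mem_filter.2 ⟨hu, huv, h⟩)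
    have h2 := (card_le_card h1).trans (card_union_le _ _)
    have h3 := hWd v (mem_filter.1 hv).1
    rcases le_or_gt e #(W.filter (fun u => G.Adj v u ∧ D.Adj u v)) with h | h
    · exact mem_union_left _ (mem_filter.2 ⟨hv, h⟩)
    · exact mem_union_right _ (mem_filter.2 ⟨hv, by omega⟩)
  have hcard := (card_le_card hcover).trans (card_union_le _ _)
  have hindep : ∀ X : Finset V, (∀ a ∈ X, ∀ b ∈ X, ¬ G.Adj a b) →
      ∀ a ∈ X, ∀ b ∈ X, ¬ D.Adj a b := by
    intro X hX a ha b hb hab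
    refine hX a ha b hb ⟨?_, Or.inl hab⟩
    rintro rfl
    exact hD _ _ hab hab
  have hGadj : ∀ {a b : V}, D.Adj a b → G.Adj a b := by
    intro a b hab
    refine ⟨?_, Or.inl hab⟩
    rintro rfl
    exact hD _ _ hab hab
  have hS₀W : S₀ ⊆ W := filter_subset _ _
  have hdeg₀ : ∀ v ∈ S₀, #(W.filter (G.Adj v)) ≤ 8 * e := fun v hv => (mem_filter.1 hv).2
  have hcases : #W ≤ 4 * #Sin ∨ #W ≤ 4 * #Sout := by omega
  rcases hcases with h | h
  -- Here arcs run from `A` to `B`, so `B` consists of sinks; the other case is the reverse.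
  · obtain ⟨A, -, B, -, hBn, hAB, hA, hB, hk, hQ⟩ := hpair G hG e le_rfl W Sin P
      (fun v u => D.Adj u v) hP1 hP2 hP3 hWn ((filter_subset _ _).trans hS₀W) h (fun v hv => hdeg₀ v (mem_filter.1 hv).1)
      (fun v hv => (mem_filter.1 hv).2)
    exact D.exists_isAntidirected_of_isIndepSet_pair A B hBn hAB (hindep A hA) (hindep B hB) hk
      (Or.inl fun v hv a ha hva => hD _ _ hva (hQ v hv a ha (hGadj hva)))
  · obtain ⟨A, -, B, -, hBn, hAB, hA, hB, hk, hQ⟩ := hpair G hG e le_rfl W Sout P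
      (fun v u => D.Adj v u) hP1 hP2 hP3 hWn ((filter_subset _ _).trans hS₀W) h (fun v hv => hdeg₀ v (mem_filter.1 hv).1)
      (fun v hv => (mem_filter.1 hv).2)
    exact D.exists_isAntidirected_of_isIndepSet_pair A B hBn hAB (hindep A hA) (hindep B hB) hk
      (Or.inr fun v hv a ha hva => hD _ _ hva (hQ v hv a ha (hGadj hva).symm))

end

theorem theorem1p2 :
    ∃ f : ℕ → ℕ → ℕ, ∀ (r d : ℕ) (V : Type*) [Fintype V] [Nonempty V] (D : Digraph V),
      D.IsOriented → f r d ≤ D.minDegree →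
        D.Contains (Digraph.transitiveTournament r) ∨
          ∃ S : Finset V, S.Nonempty ∧ (D.induce S).IsAntidirected ∧
            d ≤ (D.induce S).minDegree := by
  choose f hf using fun r d => Digraph.exists_isAntidirected_of_cliqueFree (2 ^ r) d (by positivity)
  refine ⟨f, fun r d V _ _ D hD hdeg => or_iff_not_imp_left.2 fun h => ?_⟩
  exact hf r d V D hD (D.cliqueFree_of_not_contains hD r h) hdeg
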